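/- Work in $ZF+DC_{\omega_1}$ (no further choice). Here $DC_{\omega_1}$ says: if $S,R$ are sets such that for every $\alpha<\omega_1$ and $g:\alpha\to S$ there is $y\in S$ with $(g,y)\in R$, then there is $f:\omega_1\to S$ with $(f\restriction\alpha,f(\alpha))\in R$ for all $\alpha<\omega_1$. Let $\mathbb Q$ be a set of perfect subtrees of $\omega^{<\omega}$, ordered by $p\le q$ ($q$ is stronger) iff $q\subseteq p$. For $p\in\mathbb Q$ let $tr(p)$ be its trunk (the longest node comparable with all nodes of $p$) and $\lim(p)\subseteq\omega^\omega$ its set of infinite branches. Assume that $\mathbb Q$ is a Suslin ccc forcing notion: $\mathbb Q$, its order and its incompatibility relation are (boldface) $\Sigma^1_1$, viewing $\mathcal P(\omega^{<\omega})$ as the Cantor space, and there are no $\aleph_1$ pairwise incompatible conditions. Assume also that the union of trunks $\eta=\bigcup_{p\in G}tr(p)$, $G$ being the generic filter, is a generic real for $\mathbb Q$, that is, $\mathbb Q$ forces that $\eta\in\omega^\omega$ and $G=\{p\in\mathbb Q:\eta\in\lim(p)\}$. Explicitly: for all $p\in\mathbb Q$ and $n<\omega$ there is $q\ge p$ with $|tr(q)|>n$;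 and if $p,q\in\mathbb Q$ are such that $tr(r)\in p$ for every $r\ge q$, then $p$ and $q$ are compatible. Let $I_{\mathbb Q,\aleph_0}$ be the closure, under unions of at most $\aleph_0$ sets, of the family of all $X\subseteq\omega^\omega$ such that for every $p\in\mathbb Q$ there is $q\ge p$ in $\mathbb Q$ with $\lim(q)\cap X=\emptyset$. Then the Boolean algebra $\mathrm{Borel}(\omega^\omega)/I_{\mathbb Q,\aleph_0}$ is ccc: it has no $\omega_1$-sequence of pairwise disjoint nonzero elements, and moreover every set of pairwise disjoint nonzero elements is countable. -/

import Mathlib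

/-!
The base theory here is `ZF + DC_{ω₁}`, without the axiom of choice. A statement proved in that theory
is rendered as a statement about every structure `M` for the language of set theory that satisfies
`ZF + DC_{ω₁}`. All notions below are evaluated inside `M`: every quantifier ranges over elements of
`M`, and only the membership relation of `M` is used. In particular `M` need not be transitive or
well-founded, and `ω`, `ω₁`, "countable", "Borel", ... are those of `M`.
-/

namespace SetModel

/-- The relation symbols of the language of set theory: one binary symbol. -/
inductive MemRel : ℕ → Type
  | mem : MemRel 2

/-- The first-order language of set theory. -/
def setLang : FirstOrder.Language.{0, 0} := ⟨fun _ => Empty, MemRel⟩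

section

variable {M : Type*} [setLang.Structure M]

/-- Membership of the structure `M`. -/
def Mem (x y : M) : Prop :=
  FirstOrder.Language.Structure.RelMap (L := setLang) (M := M) MemRel.mem ![x, y]

infix:50 " ε " => Mem

/-! ### Elementary set theory inside `M` -/

/-- `x ⊆ y`. -/
def Sub (x y : M) : Prop := ∀ z, z ε x → z ε y

/-- `z = {x, y}`. -/
def IsUPair (z x y : M) : Prop := ∀ v, v ε z ↔ v = x ∨ v = y

/-- `p = (x, y)`, the Kuratowski pair `{{x}, {x, y}}`. -/
def IsOPair (p x y : M) : Prop :=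
  ∃ a b, IsUPair a x x ∧ IsUPair b x y ∧ IsUPair p a b

/-- `(x, y) ∈ f`. -/
def PairMem (f x y : M) : Prop := ∃ p, IsOPair p x y ∧ p ε f

/-- `u = ⋃ F`. -/
def IsUnion (u F : M) : Prop := ∀ z, z ε u ↔ ∃ y, y ε F ∧ z ε y

/-- `s = y ∪ {y}`. -/
def IsSucc (s y : M) : Prop := ∀ z, z ε s ↔ z ε y ∨ z = y

/-- `∅ ∈ x` and `x` is closed under `y ↦ y ∪ {y}`. -/
def IsInductive (x : M) : Prop :=
  (∃ e, (∀ z, ¬ z ε e) ∧ e ε x) ∧ ∀ y, y ε x → ∃ s, IsSucc s y ∧ s ε x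

/-- `f` is a function from `A` to `B`. -/
def IsFun (f A B : M) : Prop :=
  (∀ p, p ε f → ∃ x y, x ε A ∧ y ε B ∧ IsOPair p x y) ∧ ∀ x, x ε A → ∃! y, PairMem f x y

/-- `f` is an injective function from `A` to `B`. -/
def IsInj (f A B : M) : Prop :=
  IsFun f A B ∧ ∀ x x' y, PairMem f x y → PairMem f x' y → x = x'

/-- `w` is the set `ω` of natural numbers: the least inductive set. -/
def IsOmega (w : M) : Prop := ∀ n, n ε w ↔ ∀ I, IsInductive I → n ε I

/-- `A` is finite (where `w` is `ω`). -/
def IsFinite (w A : M) : Prop := ∃ n f, n ε w ∧ IsInj f A n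

/-- `A` is countable, i.e. finite or countably infinite (where `w` is `ω`). -/
def IsCountable (w A : M) : Prop := ∃ f, IsInj f A w

/-- `a` is an ordinal: a transitive set of transitive sets. -/
def IsOrdinal (a : M) : Prop :=
  (∀ x, x ε a → Sub x a) ∧ ∀ x, x ε a → ∀ y, y ε x → Sub y x

/-- `k` is `ω₁`, the least uncountable ordinal (where `w` is `ω`). -/
def IsOmegaOne (w k : M) : Prop :=
  IsOrdinal k ∧ ¬ IsCountable w k ∧ ∀ a, a ε k → IsCountable w a

/-! ### The theory `ZF + DC_{ω₁}` -/

variable (M) in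
/-- `M` is a model of `ZF`. In the two schemata, formulas may have arbitrary parameters from `M`. -/
structure IsZF : Prop where
  extensionality : ∀ x y : M, (∀ z, z ε x ↔ z ε y) → x = y
  foundation : ∀ x : M, (∃ y, y ε x) → ∃ y, y ε x ∧ ∀ z, z ε x → ¬ z ε y
  pairing : ∀ x y : M, ∃ z, IsUPair z x y
  union : ∀ F : M, ∃ u, IsUnion u F
  powerset : ∀ x : M, ∃ p, ∀ z, z ε p ↔ Sub z x
  infinity : ∃ x : M, IsInductive x
  separation : ∀ D : Set M, (Set.univ : Set M).Definable₁ setLang D →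
    ∀ A : M, ∃ B, ∀ x, x ε B ↔ x ε A ∧ x ∈ D
  replacement : ∀ R : Set (M × M), (Set.univ : Set M).Definable₂ setLang R →
    ∀ A : M, (∀ x, x ε A → ∃! y, (x, y) ∈ R) → ∃ B, ∀ y, y ε B ↔ ∃ x, x ε A ∧ (x, y) ∈ R

variable (M) in
/-- `DC_{ω₁}`: if every function `g : α → S` with `α < ω₁` has an `R`-successor in `S`, then
there is `f : ω₁ → S` such that `f α` is an `R`-successor of `f ↾ α` for all `α < ω₁`. -/
def DCOmegaOne : Prop :=
  ∀ w k S R : M, IsOmega w → IsOmegaOne w k →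
    (∀ a g, a ε k → IsFun g a S → ∃ y, y ε S ∧ PairMem R g y) →
    ∃ f, IsFun f k S ∧
      ∀ a g y, a ε k → IsFun g a S → Sub g f → PairMem f a y → PairMem R g y

/-! ### Reals, sequences and trees. From here on, `w` stands for `ω`. -/

/-- `s` is a finite sequence of natural numbers, `s ∈ ω^{<ω}`. As sequences are functions,
`s` is an initial segment of `t` iff `s ⊆ t`. -/
def IsSeq (w s : M) : Prop := ∃ n, n ε w ∧ IsFun s n w

/-- `x` is a real, `x ∈ ω^ω`. -/
def IsReal (w x : M) : Prop := IsFun x w w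

/-- `p` is a perfect subtree of `ω^{<ω}`: a nonempty set of finite sequences, closed under
initial segments, in which every node has two incomparable extensions. -/
def IsPerfectTree (w p : M) : Prop :=
  (∃ s, s ε p) ∧ (∀ s, s ε p → IsSeq w s) ∧
  (∀ s t, t ε p → IsSeq w s → Sub s t → s ε p) ∧
  ∀ s, s ε p → ∃ t u, t ε p ∧ u ε p ∧ Sub s t ∧ Sub s u ∧ ¬ Sub t u ∧ ¬ Sub u t

/-- `s` is the trunk of `p`: the longest node of `p` that is comparable with all nodes of `p`. -/
def IsTrunk (p s : M) : Prop :=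
  (s ε p ∧ ∀ t, t ε p → Sub s t ∨ Sub t s) ∧
  ∀ s', s' ε p → (∀ t, t ε p → Sub s' t ∨ Sub t s') → Sub s' s

/-- `x ∈ lim(p)`: `x` is an infinite branch of the tree `p`. -/
def IsBranch (w p x : M) : Prop :=
  IsReal w x ∧ ∀ s, IsSeq w s → Sub s x → s ε p

/-! ### Analytic sets of subsets of `ω^{<ω}`

`P(ω^{<ω})` is identified with the Cantor space `2^{ω^{<ω}}`. -/

/-- `p ⊆ ω^{<ω}`. -/
def IsSeqSet (w p : M) : Prop := ∀ s, s ε p → IsSeq w s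

/-- `p ∩ F = p' ∩ F`. -/
def AgreeOn (F p p' : M) : Prop := ∀ s, s ε F → (s ε p ↔ s ε p')

/-- `((p, q), z) ∈ C`. -/
def TripleMem (C p q z : M) : Prop := ∃ a, IsOPair a p q ∧ PairMem C a z

/-- `C` (restricted to triples of this kind) is closed in
`P(ω^{<ω}) × P(ω^{<ω}) × ω^ω`: every adherent point of `C` belongs to `C`. -/
def IsClosedSet (w C : M) : Prop :=
  ∀ p q z, IsSeqSet w p → IsSeqSet w q → IsReal w z →
    (∀ F n, IsFinite w F → IsSeqSet w F → n ε w →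
      ∃ p' q' z', IsSeqSet w p' ∧ IsSeqSet w q' ∧ IsReal w z' ∧ TripleMem C p' q' z' ∧
        AgreeOn F p p' ∧ AgreeOn F q q' ∧
        ∀ m y, m ε n → (PairMem z m y ↔ PairMem z' m y)) →
    TripleMem C p q z

/-- The binary relation `R` on `P(ω^{<ω})` is (boldface) `Σ¹₁`: it is the projection of a closed
subset of `P(ω^{<ω}) × P(ω^{<ω}) × ω^ω`. -/
def IsAnalytic (w : M) (R : M → M → Prop) : Prop :=
  ∃ C, IsClosedSet w C ∧
    ∀ p q, IsSeqSet w p → IsSeqSet w q → (R p q ↔ ∃ z, IsReal w z ∧ TripleMem C p q z)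

/-! ### Forcing notions consisting of perfect trees

The order of `Q` is reverse inclusion: `p ≤ q` (`q` is stronger) iff `q ⊆ p`. -/

/-- The conditions `p` and `q` are compatible in `Q`. -/
def Compat (Q p q : M) : Prop := ∃ r, r ε Q ∧ Sub r p ∧ Sub r q

/-- `Q` is Suslin: the set of conditions, the order and the incompatibility relation are `Σ¹₁`.
(A set `A` is `Σ¹₁` iff the cylinder over `A` is.) -/
def IsSuslin (w Q : M) : Prop :=
  IsAnalytic w (fun p _ => p ε Q) ∧
  IsAnalytic w (fun p q => p ε Q ∧ q ε Q ∧ Sub q p) ∧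
  IsAnalytic w (fun p q => p ε Q ∧ q ε Q ∧ ¬ Compat Q p q)

/-- `Q` is ccc: there are no `ℵ₁` pairwise incompatible conditions (`k` stands for `ω₁`). -/
def IsCCC (k Q : M) : Prop :=
  ¬ ∃ f, IsFun f k Q ∧
    ∀ a b p q, a ≠ b → PairMem f a p → PairMem f b q → ¬ Compat Q p q

/-- The generic real of `Q` is `η = ⋃ {tr(p) : p ∈ G}`. By definition of forcing,
the first clause says that `η ∈ ω^ω` is forced. A condition `q` forces `η ∈ lim(p)` iff
`tr(r) ∈ p` for all `r ≥ q`, and the second clause says that `η ∈ lim(p) → p ∈ G` is forced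
for every `p ∈ Q`, hence (the converse being automatic) that `G = {p ∈ Q : η ∈ lim(p)}`
is forced: the generic filter is read off from its generic real. -/
def HasGenericReal (w Q : M) : Prop :=
  (∀ p n, p ε Q → n ε w → ∃ q s, q ε Q ∧ Sub q p ∧ IsTrunk q s ∧ ∃ y, PairMem s n y) ∧
  ∀ p q, p ε Q → q ε Q →
    (∀ r s, r ε Q → Sub r q → IsTrunk r s → s ε p) → Compat Q p q

/-- `Q` is a Suslin ccc forcing notion whose conditions are perfect trees ordered by reverse
inclusion, with the union of the trunks as generic real. -/
structure IsSuslinCCCTreeForcing (w k Q : M) : Prop where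
  perfect : ∀ p, p ε Q → IsPerfectTree w p
  generic : HasGenericReal w Q
  suslin : IsSuslin w Q
  ccc : IsCCC k Q

/-! ### The ideal `I_{Q,ℵ₀}` -/

/-- `X ⊆ ω^ω` and every condition `p` has an extension `q` with `lim(q) ∩ X = ∅`. -/
def IsSmall (w Q X : M) : Prop :=
  (∀ x, x ε X → IsReal w x) ∧
  ∀ p, p ε Q → ∃ q, q ε Q ∧ Sub q p ∧ ∀ x, x ε X → ¬ IsBranch w q x

/-- `X ∈ I_{Q,ℵ₀}`, the closure of the family of small sets under unions of size `≤ ℵ₀`. -/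
def InIdeal (w Q X : M) : Prop :=
  ∀ J, (∀ Y, IsSmall w Q Y → Y ε J) →
    (∀ F U, IsCountable w F → Sub F J → IsUnion U F → U ε J) → X ε J

/-! ### Borel sets and the Boolean algebra `Borel(ω^ω) / I_{Q,ℵ₀}` -/

/-- `B` is a Borel subset of `ω^ω`: it belongs to every family of sets that contains the
basic open sets `{x ∈ ω^ω : s ⊆ x}` and is closed under complements in `ω^ω` and countable
unions. -/
def IsBorel (w B : M) : Prop :=
  ∀ S, (∀ s O, IsSeq w s → (∀ x, x ε O ↔ IsReal w x ∧ Sub s x) → O ε S) →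
    (∀ Y Z, Y ε S → (∀ x, x ε Z ↔ IsReal w x ∧ ¬ x ε Y) → Z ε S) →
    (∀ F U, IsCountable w F → Sub F S → IsUnion U F → U ε S) → B ε S

/-- `B = C` modulo `I_{Q,ℵ₀}`, i.e. the symmetric difference of `B` and `C` is in the ideal. -/
def EqMod (w Q B C : M) : Prop :=
  ∃ D, (∀ x, x ε D ↔ (x ε B ∧ ¬ x ε C) ∨ (x ε C ∧ ¬ x ε B)) ∧ InIdeal w Q D

/-- `X` is an element of `Borel(ω^ω) / I_{Q,ℵ₀}`: the class of some Borel set `B`. -/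
def IsClass (w Q X : M) : Prop :=
  ∃ B, IsBorel w B ∧ ∀ C, C ε X ↔ IsBorel w C ∧ EqMod w Q B C

/-- `X` is a nonzero element of `Borel(ω^ω) / I_{Q,ℵ₀}`. -/
def IsPosClass (w Q X : M) : Prop :=
  IsClass w Q X ∧ ∀ B, B ε X → ¬ InIdeal w Q B

/-- The meet of the elements `X` and `Y` of `Borel(ω^ω) / I_{Q,ℵ₀}` is zero. -/
def DisjointClasses (w Q X Y : M) : Prop :=
  ∀ B C D, B ε X → C ε Y → (∀ x, x ε D ↔ x ε B ∧ x ε C) → InIdeal w Q D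

/-- `Borel(ω^ω) / I_{Q,ℵ₀}` is ccc, first in the sense that it has no `ω₁`-sequence of
pairwise disjoint nonzero elements, and also in the sense that all of its antichains are
countable. -/
def BorelQuotientCCC (w k Q : M) : Prop :=
  (¬ ∃ f A, (∀ X, X ε A → IsPosClass w Q X) ∧ IsFun f k A ∧
    ∀ a b X Y, a ≠ b → PairMem f a X → PairMem f b Y → DisjointClasses w Q X Y) ∧
  ∀ A, (∀ X, X ε A → IsPosClass w Q X) →
    (∀ X Y, X ε A → Y ε A → X ≠ Y → DisjointClasses w Q X Y) → IsCountable w A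

end

end SetModel

/-! The proof is Baire category theory for `Q`, with small sets playing the role of nowhere dense
sets. Two small sets have a small union, so the ideal consists of the sets of reals covered by an
increasing `ω`-sequence of small sets (`inIdeal_iff`); call these meager.

Three facts carry the argument. By ccc and `DC_{ω₁}`, every set of conditions has a countable
predense subset (`exists_countable_predense`), so a set that is meager below densely many conditions
is meager (`isMeagerPred_of_dense`). Since trunks grow and unite to a branch, `lim r` is never
meager (`not_isMeagerPred_branch`). Since the generic real determines the generic filter, a
condition incompatible with `p` can be extended to one with no branch in common with `p`
(`exists_disjoint`).

As in the classical proof of the Baire property, these show that a Borel set outside the ideal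
contains almost all of some `lim q` (`exists_condition`). Conditions obtained in this way from
disjoint classes are incompatible (`not_compat`). Without choice one cannot pick a condition for
each class of an antichain. Instead, a countable predense subset of the set of all such conditions
meets every class, and each of its members belongs to only one class.

Everything is evaluated inside `M`, so separation needs first-order formulas. The classes `Trm` and
`Dfn` let instance search build them. -/

namespace SetModel

/-! ### First-order definable predicates with parameters -/

section Definability

open FirstOrder Language

variable {M : Type*} [setLang.Structure M]

/-- `t` is a variable or a parameter, as a function of the assignment of the variables. -/
class Trm (t : (ℕ → M) → M) : Prop where
  out : ∃ τ : (setLang[[(Set.univ : Set M)]]).Term ℕ, ∀ v, τ.realize v = t v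

/-- `P` is a first-order property, with parameters, of the assignment of the variables. -/
class Dfn (P : (ℕ → M) → Prop) : Prop where
  out : ∃ φ : (setLang[[(Set.univ : Set M)]]).Formula ℕ, ∀ v, φ.Realize v ↔ P v

instance Trm.var (i : ℕ) : Trm (fun v : ℕ → M => v i) := ⟨Term.var i, fun _ => rfl⟩

instance Trm.const (c : M) : Trm (fun _ : ℕ → M => c) :=
  ⟨Constants.term (Language.con setLang (⟨c, trivial⟩ : (Set.univ : Set M))), fun v => by simp⟩

instance Dfn.eq {a b : (ℕ → M) → M} [ha : Trm a] [hb : Trm b] : Dfn (fun v => a v = b v) := by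
  obtain ⟨s, hs⟩ := ha.out
  obtain ⟨t, ht⟩ := hb.out
  exact ⟨s.equal t, fun v => by simp [hs, ht]⟩

instance Dfn.mem {a b : (ℕ → M) → M} [ha : Trm a] [hb : Trm b] : Dfn (fun v => a v ε b v) := by
  obtain ⟨s, hs⟩ := ha.out
  obtain ⟨t, ht⟩ := hb.out
  let r : setLang.Relations 2 := MemRel.mem
  refine ⟨Relations.formula₂ (Sum.inl r : (setLang[[(Set.univ : Set M)]]).Relations 2) s t,
    fun v => ?_⟩
  have h : _ ↔ Structure.RelMap r ![a v, b v] :=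
    (Formula.realize_rel₂ (R := (Sum.inl r : (setLang[[(Set.univ : Set M)]]).Relations 2))
      (v := v) (t₁ := s) (t₂ := t)).trans (by rw [hs, ht]; rfl)
  exact h

instance Dfn.not {P : (ℕ → M) → Prop} [hP : Dfn P] : Dfn (fun v => ¬ P v) := by
  obtain ⟨φ, h⟩ := hP.out
  exact ⟨φ.not, fun v => by simp [h]⟩

instance Dfn.and {P R : (ℕ → M) → Prop} [hP : Dfn P] [hR : Dfn R] : Dfn (fun v => P v ∧ R v) := by
  obtain ⟨φ, h⟩ := hP.out
  obtain ⟨ψ, h'⟩ := hR.out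
  exact ⟨φ ⊓ ψ, fun v => by simp [h, h']⟩

instance Dfn.or {P R : (ℕ → M) → Prop} [hP : Dfn P] [hR : Dfn R] : Dfn (fun v => P v ∨ R v) := by
  obtain ⟨φ, h⟩ := hP.out
  obtain ⟨ψ, h'⟩ := hR.out
  exact ⟨φ ⊔ ψ, fun v => by simp [h, h']⟩

instance Dfn.imp {P R : (ℕ → M) → Prop} [hP : Dfn P] [hR : Dfn R] : Dfn (fun v => P v → R v) := by
  obtain ⟨φ, h⟩ := hP.out
  obtain ⟨ψ, h'⟩ := hR.out
  exact ⟨φ.imp ψ, fun v => by simp [h, h']⟩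

instance Dfn.iff {P R : (ℕ → M) → Prop} [hP : Dfn P] [hR : Dfn R] : Dfn (fun v => P v ↔ R v) := by
  obtain ⟨φ, h⟩ := hP.out
  obtain ⟨ψ, h'⟩ := hR.out
  exact ⟨φ.iff ψ, fun v => by simp [h, h']⟩

instance Dfn.ne {a b : (ℕ → M) → M} [Trm a] [Trm b] : Dfn (fun v => a v ≠ b v) :=
  inferInstanceAs (Dfn (fun v => ¬ a v = b v))

/-- De Bruijn convention: under a quantifier, variable `0` is the bound one and the outer variables
are shifted by one. -/
instance Dfn.ex {P : (ℕ → M) → M → Prop} [hP : Dfn (fun v => P (fun i => v (i + 1)) (v 0))] :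
    Dfn (fun v => ∃ x, P v x) := by
  obtain ⟨φ, h⟩ := hP.out
  let g : ℕ → ℕ ⊕ Fin 1 := fun i => Nat.casesOn i (Sum.inr 0) Sum.inl
  refine ⟨Formula.iExs (Fin 1) (φ.relabel g), fun v => ?_⟩
  rw [Formula.realize_iExs]
  constructor
  · rintro ⟨i, hi⟩
    rw [Formula.realize_relabel, h] at hi
    exact ⟨_, hi⟩
  · rintro ⟨x, hx⟩
    refine ⟨fun _ => x, ?_⟩
    rw [Formula.realize_relabel, h]
    exact hx

instance Dfn.all {P : (ℕ → M) → M → Prop} [Dfn (fun v => P (fun i => v (i + 1)) (v 0))] :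
    Dfn (fun v => ∀ x, P v x) := by
  have h : Dfn (fun v => ¬ ∃ x, ¬ P v x) := inferInstance
  simpa only [not_exists, not_not] using h

/-- The uniqueness clause lies under two quantifiers, which is why the shift by two is also
required. -/
instance Dfn.exUnique {P : (ℕ → M) → M → Prop} [Dfn (fun v => P (fun i => v (i + 1)) (v 0))]
    [Dfn (fun v => P (fun i => v (i + 2)) (v 0))] :
    Dfn (fun v => ∃! x, P v x) :=
  inferInstanceAs (Dfn (fun v => ∃ x, P v x ∧ ∀ y, P v y → y = x))

/-- Substitution of variables and parameters. -/
theorem Dfn.comp {P : (ℕ → M) → Prop} [hP : Dfn P] (a : ℕ → (ℕ → M) → M) (ha : ∀ i, Trm (a i)) :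
    Dfn (fun v => P (fun i => a i v)) := by
  obtain ⟨φ, h⟩ := hP.out
  choose τ hτ using fun i => (ha i).out
  refine ⟨BoundedFormula.subst φ τ, fun v => ?_⟩
  rw [← h, Formula.Realize, BoundedFormula.realize_subst]
  simp only [hτ]
  rfl

theorem Dfn.comp₁ {P : M → Prop} [Dfn (fun v => P (v 0))] (a : (ℕ → M) → M) [Trm a] :
    Dfn (fun v => P (a v)) :=
  Dfn.comp (P := fun v => P (v 0)) (fun _ => a) (fun _ => inferInstance)

theorem Dfn.comp₂ {P : M → M → Prop} [Dfn (fun v => P (v 0) (v 1))] (a b : (ℕ → M) → M)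
    [Trm a] [Trm b] : Dfn (fun v => P (a v) (b v)) :=
  Dfn.comp (P := fun v => P (v 0) (v 1)) (fun i => Nat.casesOn i a (fun _ => b))
    (fun i => by cases i <;> infer_instance)

theorem Dfn.comp₃ {P : M → M → M → Prop} [Dfn (fun v => P (v 0) (v 1) (v 2))]
    (a b c : (ℕ → M) → M) [Trm a] [Trm b] [Trm c] : Dfn (fun v => P (a v) (b v) (c v)) :=
  Dfn.comp (P := fun v => P (v 0) (v 1) (v 2))
    (fun i => Nat.casesOn i a (fun j => Nat.casesOn j b (fun _ => c)))
    (fun i => by rcases i with _ | _ | i <;> infer_instance)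

theorem IsZF.sep (h : IsZF M) (P : M → Prop) [hP : Dfn (fun v => P (v 0))] (A : M) :
    ∃ B, ∀ x, x ε B ↔ x ε A ∧ P x := by
  obtain ⟨φ, hφ⟩ := hP.out
  -- `P` reads only variable `0`, so all variables may be identified.
  refine h.separation {x | P x} ⟨φ.relabel (fun _ => 0), ?_⟩ A
  ext v
  simp only [Set.mem_ofPred_eq, Formula.realize_relabel, hφ]
  rfl

/-! The notions defined above are first-order. -/

variable {a b c : (ℕ → M) → M} [Trm a] [Trm b] [Trm c]

instance : Dfn (fun v => Sub (a v) (b v)) :=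
  have : Dfn (fun v : ℕ → M => Sub (v 0) (v 1)) := by unfold Sub; infer_instance
  Dfn.comp₂ a b
instance : Dfn (fun v => IsUPair (a v) (b v) (c v)) :=
  have : Dfn (fun v : ℕ → M => IsUPair (v 0) (v 1) (v 2)) := by unfold IsUPair; infer_instance
  Dfn.comp₃ a b c
instance : Dfn (fun v => IsOPair (a v) (b v) (c v)) :=
  have : Dfn (fun v : ℕ → M => IsOPair (v 0) (v 1) (v 2)) := by unfold IsOPair; infer_instance
  Dfn.comp₃ a b c
instance : Dfn (fun v => PairMem (a v) (b v) (c v)) :=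
  have : Dfn (fun v : ℕ → M => PairMem (v 0) (v 1) (v 2)) := by unfold PairMem; infer_instance
  Dfn.comp₃ a b c
instance : Dfn (fun v => IsFun (a v) (b v) (c v)) :=
  have : Dfn (fun v : ℕ → M => IsFun (v 0) (v 1) (v 2)) := by unfold IsFun; infer_instance
  Dfn.comp₃ a b c
instance : Dfn (fun v => IsSeq (a v) (b v)) :=
  have : Dfn (fun v : ℕ → M => IsSeq (v 0) (v 1)) := by unfold IsSeq; infer_instance
  Dfn.comp₂ a b
instance : Dfn (fun v => IsReal (a v) (b v)) :=
  have : Dfn (fun v : ℕ → M => IsReal (v 0) (v 1)) := by unfold IsReal; infer_instance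
  Dfn.comp₂ a b
instance : Dfn (fun v => IsTrunk (a v) (b v)) :=
  have : Dfn (fun v : ℕ → M => IsTrunk (v 0) (v 1)) := by unfold IsTrunk; infer_instance
  Dfn.comp₂ a b
instance : Dfn (fun v => IsBranch (a v) (b v) (c v)) :=
  have : Dfn (fun v : ℕ → M => IsBranch (v 0) (v 1) (v 2)) := by unfold IsBranch; infer_instance
  Dfn.comp₃ a b c
instance : Dfn (fun v => Compat (a v) (b v) (c v)) :=
  have : Dfn (fun v : ℕ → M => Compat (v 0) (v 1) (v 2)) := by unfold Compat; infer_instance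
  Dfn.comp₃ a b c

end Definability

/-! ### Elementary set theory and dependent choice inside `M` -/

section Basics

variable {M : Type*} [setLang.Structure M]

/-! ### Pairs, relations and functions in a model of `ZF` -/

theorem IsZF.exists_empty (h : IsZF M) : ∃ e : M, ∀ z, ¬ z ε e := by
  obtain ⟨e, he, -⟩ := h.infinity.choose_spec.1
  exact ⟨e, he⟩

theorem IsZF.exists_opair (h : IsZF M) (x y : M) : ∃ p, IsOPair p x y := by
  obtain ⟨a, ha⟩ := h.pairing x x
  obtain ⟨b, hb⟩ := h.pairing x y
  obtain ⟨p, hp⟩ := h.pairing a b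
  exact ⟨p, a, b, ha, hb, hp⟩

theorem IsUPair.unique (h : IsZF M) {z z' x y : M} (hz : IsUPair z x y) (hz' : IsUPair z' x y) :
    z = z' :=
  h.extensionality _ _ fun v => (hz v).trans (hz' v).symm

theorem IsOPair.unique (h : IsZF M) {p q x y : M} (hp : IsOPair p x y) (hq : IsOPair q x y) :
    p = q := by
  obtain ⟨a, b, ha, hb, hp⟩ := hp
  obtain ⟨a', b', ha', hb', hq⟩ := hq
  obtain rfl := ha.unique h ha'
  obtain rfl := hb.unique h hb'
  exact hp.unique h hq

theorem IsOPair.inj {p x y x' y' : M} (hp : IsOPair p x y) (hq : IsOPair p x' y') :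
    x = x' ∧ y = y' := by
  obtain ⟨a, b, ha, hb, hp⟩ := hp
  obtain ⟨a', b', ha', hb', hq⟩ := hq
  have e1 : ∀ v, v ε a ↔ v = x := fun v => by rw [ha v, or_self]
  have e2 : ∀ v, v ε a' ↔ v = x' := fun v => by rw [ha' v, or_self]
  have hab : ∀ v, (v = a ∨ v = b) ↔ (v = a' ∨ v = b') := fun v => (hp v).symm.trans (hq v)
  have hx : x = x' := by
    rcases (hab a).1 (Or.inl rfl) with rfl | rfl
    · exact (e2 x).1 ((e1 x).2 rfl)
    · exact ((e1 x').1 ((hb' x').2 (Or.inl rfl))).symm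
  subst hx
  refine ⟨rfl, ?_⟩
  have h1 : y = x ∨ y = y' := by
    rcases (hab b).1 (Or.inr rfl) with rfl | rfl
    · exact Or.inl ((e2 y).1 ((hb y).2 (Or.inr rfl)))
    · exact (hb' y).1 ((hb y).2 (Or.inr rfl))
  have h2 : y' = x ∨ y' = y := by
    rcases (hab b').2 (Or.inr rfl) with rfl | rfl
    · exact Or.inl ((e1 y').1 ((hb' y').2 (Or.inr rfl)))
    · exact (hb y').1 ((hb' y').2 (Or.inr rfl))
  rcases h1 with h1 | h1
  · rcases h2 with h2 | h2
    · rw [h1, h2]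
    · exact h2.symm
  · exact h1

theorem Sub.pairMem {f g x y : M} (h : Sub f g) (hf : PairMem f x y) : PairMem g x y :=
  let ⟨p, hp, hpf⟩ := hf
  ⟨p, hp, h p hpf⟩

theorem Sub.trans {x y z : M} (h : Sub x y) (h' : Sub y z) : Sub x z := fun v hv => h' v (h v hv)

theorem Sub.refl (x : M) : Sub x x := fun _ hv => hv

theorem PairMem.of_opair (h : IsZF M) {f p x y : M} (hf : PairMem f x y) (hp : IsOPair p x y) :
    p ε f := by
  obtain ⟨q, hq, hqf⟩ := hf
  rwa [hp.unique h hq]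

theorem IsZF.exists_prod (h : IsZF M) (A B : M) :
    ∃ C, ∀ p, p ε C ↔ ∃ x y, x ε A ∧ y ε B ∧ IsOPair p x y := by
  obtain ⟨F, hF⟩ := h.pairing A B
  obtain ⟨U, hU⟩ := h.union F
  obtain ⟨V, hV⟩ := h.powerset U
  obtain ⟨W, hW⟩ := h.powerset V
  obtain ⟨C, hC⟩ := h.sep (fun p => ∃ x y, x ε A ∧ y ε B ∧ IsOPair p x y) W
  refine ⟨C, fun p => (hC p).trans (and_iff_right_of_imp ?_)⟩
  rintro ⟨x, y, hx, hy, a, b, ha, hb, hp⟩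
  have hxU : x ε U := (hU x).2 ⟨A, (hF A).2 (Or.inl rfl), hx⟩
  have hyU : y ε U := (hU y).2 ⟨B, (hF B).2 (Or.inr rfl), hy⟩
  refine (hW p).2 fun c hc => (hV c).2 fun z hz => ?_
  rcases (hp c).1 hc with rfl | rfl
  · rcases (ha z).1 hz with rfl | rfl <;> exact hxU
  · rcases (hb z).1 hz with rfl | rfl <;> assumption

theorem IsZF.exists_rel (h : IsZF M) (P : M → M → Prop) [Dfn (fun v => P (v 0) (v 1))] (A B : M) :
    ∃ R, (∀ p, p ε R → ∃ x y, x ε A ∧ y ε B ∧ IsOPair p x y) ∧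
      ∀ x y, PairMem R x y ↔ x ε A ∧ y ε B ∧ P x y := by
  -- Closing the hypothesis under substitution makes it a local instance that is usable inside
  -- larger formulas.
  have : ∀ a b : (ℕ → M) → M, ∀ [Trm a] [Trm b], Dfn (fun v => P (a v) (b v)) :=
    fun a b _ _ => Dfn.comp₂ a b
  obtain ⟨C, hC⟩ := h.exists_prod A B
  obtain ⟨R, hR⟩ := h.sep (fun p => ∃ x y, IsOPair p x y ∧ P x y) C
  refine ⟨R, fun p hp => (hC p).1 ((hR p).1 hp).1, fun x y => ⟨?_, ?_⟩⟩
  · rintro ⟨p, hp, hpR⟩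
    obtain ⟨hpC, x', y', hp', hP⟩ := (hR p).1 hpR
    obtain ⟨x'', y'', hx, hy, hp''⟩ := (hC p).1 hpC
    obtain ⟨rfl, rfl⟩ := hp.inj hp'
    obtain ⟨rfl, rfl⟩ := hp.inj hp''
    exact ⟨hx, hy, hP⟩
  · rintro ⟨hx, hy, hP⟩
    obtain ⟨p, hp⟩ := h.exists_opair x y
    exact ⟨p, hp, (hR p).2 ⟨(hC p).2 ⟨x, y, hx, hy, hp⟩, x, y, hp, hP⟩⟩

theorem IsZF.exists_fun (h : IsZF M) (P : M → M → Prop) [Dfn (fun v => P (v 0) (v 1))] (A B : M)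
    (hP : ∀ x, x ε A → ∃! y, y ε B ∧ P x y) :
    ∃ f, IsFun f A B ∧ ∀ x y, PairMem f x y ↔ x ε A ∧ y ε B ∧ P x y := by
  obtain ⟨f, hf, hf'⟩ := h.exists_rel P A B
  refine ⟨f, ⟨hf, fun x hx => ?_⟩, hf'⟩
  obtain ⟨y, hy, hu⟩ := hP x hx
  exact ⟨y, (hf' x y).2 ⟨hx, hy⟩, fun z hz => hu z ((hf' x z).1 hz).2⟩

theorem IsFun.mem {f A B x y : M} (hf : IsFun f A B) (hxy : PairMem f x y) : x ε A ∧ y ε B := by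
  obtain ⟨p, hp, hpf⟩ := hxy
  obtain ⟨x', y', hx, hy, hp'⟩ := hf.1 p hpf
  obtain ⟨rfl, rfl⟩ := hp.inj hp'
  exact ⟨hx, hy⟩

theorem IsFun.exists_val {f A B x : M} (hf : IsFun f A B) (hx : x ε A) :
    ∃ y, y ε B ∧ PairMem f x y := by
  obtain ⟨y, hy, -⟩ := hf.2 x hx
  exact ⟨y, (hf.mem hy).2, hy⟩

theorem IsFun.eq {f A B x y y' : M} (hf : IsFun f A B) (hy : PairMem f x y)
    (hy' : PairMem f x y') : y = y' :=
  (hf.2 x (hf.mem hy).1).unique hy hy'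

theorem IsFun.sub (h : IsZF M) {f g A B : M} (hf : IsFun f A B)
    (hfg : ∀ x y, PairMem f x y → PairMem g x y) : Sub f g := by
  intro p hp
  obtain ⟨x, y, -, -, hxy⟩ := hf.1 p hp
  exact (hfg x y ⟨p, hxy, hp⟩).of_opair h hxy

theorem IsFun.restrict (h : IsZF M) {f A B a : M} (hf : IsFun f A B) (ha : Sub a A) :
    ∃ g, IsFun g a B ∧ Sub g f ∧ ∀ x y, PairMem g x y ↔ x ε a ∧ PairMem f x y := by
  obtain ⟨g, hg, hg'⟩ := h.exists_fun (fun x y => PairMem f x y) a B fun x hx => by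
    obtain ⟨y, hy, hxy⟩ := hf.exists_val (ha x hx)
    exact ⟨y, ⟨hy, hxy⟩, fun z hz => hf.eq hz.2 hxy⟩
  refine ⟨g, hg, hg.sub h fun x y hxy => ((hg' x y).1 hxy).2.2, fun x y => (hg' x y).trans ?_⟩
  exact ⟨fun H => ⟨H.1, H.2.2⟩, fun H => ⟨H.1, (hf.mem H.2).2, H.2⟩⟩

/-! ### Ordinals and `ω` -/

theorem IsZF.exists_min (h : IsZF M) (P : M → Prop) [Dfn (fun v => P (v 0))] (A : M)
    (hA : ∃ x, x ε A ∧ P x) : ∃ x, x ε A ∧ P x ∧ ∀ y, y ε A → y ε x → ¬ P y := by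
  obtain ⟨B, hB⟩ := h.sep P A
  obtain ⟨x, hx⟩ := hA
  obtain ⟨m, hm, hm'⟩ := h.foundation B ⟨x, (hB x).2 hx⟩
  exact ⟨m, ((hB m).1 hm).1, ((hB m).1 hm).2, fun y hyA hym hy => hm' y ((hB y).2 ⟨hyA, hy⟩) hym⟩

theorem IsZF.exists_succ (h : IsZF M) (x : M) : ∃ s, IsSucc s x := by
  obtain ⟨a, ha⟩ := h.pairing x x
  obtain ⟨b, hb⟩ := h.pairing x a
  obtain ⟨s, hs⟩ := h.union b
  refine ⟨s, fun z => (hs z).trans ⟨?_, ?_⟩⟩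
  · rintro ⟨y, hy, hz⟩
    rcases (hb y).1 hy with rfl | rfl
    · exact Or.inl hz
    · exact Or.inr (by simpa using (ha z).1 hz)
  · rintro (hz | rfl)
    · exact ⟨x, (hb x).2 (Or.inl rfl), hz⟩
    · exact ⟨a, (hb a).2 (Or.inr rfl), (ha z).2 (Or.inl rfl)⟩

theorem IsOrdinal.of_mem {a b : M} (hb : IsOrdinal b) (ha : a ε b) : IsOrdinal a :=
  ⟨hb.2 a ha, fun x hx => hb.2 x (hb.1 a ha x hx)⟩

theorem IsOrdinal.trichotomy (h : IsZF M) {a b : M} (ha : IsOrdinal a) (hb : IsOrdinal b) :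
    a ε b ∨ a = b ∨ b ε a := by
  by_contra hab
  obtain ⟨A, hA⟩ := h.exists_succ a
  obtain ⟨B, hB⟩ := h.exists_succ b
  have oA : ∀ x, x ε A → IsOrdinal x := fun x hx =>
    ((hA x).1 hx).elim ha.of_mem (fun e => e ▸ ha)
  have oB : ∀ x, x ε B → IsOrdinal x := fun x hx =>
    ((hB x).1 hx).elim hb.of_mem (fun e => e ▸ hb)
  have tA : ∀ x y, x ε A → y ε x → y ε A := fun x y hx hy =>
    (hA y).2 (Or.inl (((hA x).1 hx).elim (fun hx => ha.1 x hx y hy) (fun e => e ▸ hy)))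
  have tB : ∀ x y, x ε B → y ε x → y ε B := fun x y hx hy =>
    (hB y).2 (Or.inl (((hB x).1 hx).elim (fun hx => hb.1 x hx y hy) (fun e => e ▸ hy)))
  -- Take `c` minimal in `a ∪ {a}` among the elements incomparable with some element of `b ∪ {b}`,
  -- then `d` minimal among the latter for this `c`. Minimality forces `c = d`, a contradiction.
  obtain ⟨c, hcA, ⟨d', hd'⟩, hc⟩ := h.exists_min
    (fun x => ∃ y, y ε B ∧ ¬ (x ε y ∨ x = y ∨ y ε x)) A
    ⟨a, (hA a).2 (Or.inr rfl), b, (hB b).2 (Or.inr rfl), hab⟩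
  obtain ⟨d, hdB, hcd, hd⟩ := h.exists_min (fun y => ¬ (c ε y ∨ c = y ∨ y ε c)) B ⟨d', hd'⟩
  apply hcd
  refine Or.inr (Or.inl (h.extensionality _ _ fun z => ⟨fun hz => ?_, fun hz => ?_⟩))
  · have := hc z (tA c z hcA hz) hz
    push Not at this
    rcases this d hdB with h1 | rfl | h1
    · exact h1
    · exact absurd (Or.inr (Or.inr hz)) hcd
    · exact absurd (Or.inr (Or.inr ((oA c hcA).1 z hz d h1))) hcd
  · rcases not_not.1 (hd z (tB d z hdB hz) hz) with h1 | rfl | h1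
    · exact absurd (Or.inl ((oB d hdB).1 z hz c h1)) hcd
    · exact absurd (Or.inl hz) hcd
    · exact h1

theorem IsOmega.zero_mem {w e : M} (h : IsZF M) (hw : IsOmega w) (he : ∀ z, ¬ z ε e) : e ε w := by
  refine (hw e).2 fun I hI => ?_
  obtain ⟨e', he', heI⟩ := hI.1
  rwa [h.extensionality e e' fun z => ⟨fun H => absurd H (he z), fun H => absurd H (he' z)⟩]

theorem IsOmega.succ_mem {w n s : M} (h : IsZF M) (hw : IsOmega w) (hn : n ε w)
    (hs : IsSucc s n) : s ε w := by
  refine (hw s).2 fun I hI => ?_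
  obtain ⟨s', hs', hsI⟩ := hI.2 n ((hw n).1 hn I hI)
  rwa [h.extensionality s s' fun z => (hs z).trans (hs' z).symm]

theorem IsOmega.induction {w : M} (h : IsZF M) (hw : IsOmega w) (P : M → Prop)
    [Dfn (fun v => P (v 0))] (h0 : ∀ e, (∀ z, ¬ z ε e) → P e)
    (hs : ∀ n s, n ε w → P n → IsSucc s n → P s) {n : M} (hn : n ε w) : P n := by
  obtain ⟨I, hI⟩ := h.sep P w
  refine ((hI n).1 ((hw n).1 hn I ⟨?_, fun m hm => ?_⟩)).2
  · obtain ⟨e, he⟩ := h.exists_empty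
    exact ⟨e, he, (hI e).2 ⟨hw.zero_mem h he, h0 e he⟩⟩
  · obtain ⟨s, hs'⟩ := h.exists_succ m
    obtain ⟨hmw, hm⟩ := (hI m).1 hm
    exact ⟨s, hs', (hI s).2 ⟨hw.succ_mem h hmw hs', hs m s hmw hm hs'⟩⟩

theorem IsOmega.isOrdinal {w : M} (h : IsZF M) (hw : IsOmega w) : IsOrdinal w := by
  refine ⟨fun n hn => ?_, fun n hn => ?_⟩
  · refine hw.induction h (fun n => Sub n w) (fun e he z hz => absurd hz (he z)) ?_ hn
    intro n s hn ih hs z hz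
    rcases (hs z).1 hz with hz | rfl
    · exact ih z hz
    · exact hn
  · refine hw.induction h (fun n => ∀ y, y ε n → Sub y n) (fun e he z hz => absurd hz (he z)) ?_ hn
    intro n s hn ih hs y hy z hz
    rcases (hs y).1 hy with hy | rfl
    · exact (hs z).2 (Or.inl (ih y hy z hz))
    · exact (hs z).2 (Or.inl hz)

theorem IsOmega.trans {w m n : M} (h : IsZF M) (hw : IsOmega w) (hn : n ε w) (hm : m ε n) :
    m ε w :=
  (hw.isOrdinal h).1 n hn m hm

theorem IsOmega.trichotomy {w m n : M} (h : IsZF M) (hw : IsOmega w) (hm : m ε w) (hn : n ε w) :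
    m ε n ∨ m = n ∨ n ε m :=
  ((hw.isOrdinal h).of_mem hm).trichotomy h ((hw.isOrdinal h).of_mem hn)

/-- Two natural numbers are contained in a third one. -/
theorem IsOmega.exists_mem_mem {w m n : M} (h : IsZF M) (hw : IsOmega w) (hm : m ε w)
    (hn : n ε w) : ∃ l, l ε w ∧ m ε l ∧ n ε l := by
  obtain ⟨s, hs⟩ := h.exists_succ m
  obtain ⟨t, ht⟩ := h.exists_succ n
  rcases hw.trichotomy h hm hn with H | rfl | H
  · exact ⟨t, hw.succ_mem h hn ht, (ht m).2 (Or.inl H), (ht n).2 (Or.inr rfl)⟩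
  · exact ⟨s, hw.succ_mem h hm hs, (hs m).2 (Or.inr rfl), (hs m).2 (Or.inr rfl)⟩
  · exact ⟨s, hw.succ_mem h hm hs, (hs m).2 (Or.inr rfl), (hs n).2 (Or.inl H)⟩

/-! ### Countable sets -/

theorem IsCountable.of_sub (h : IsZF M) {w A : M} (hA : Sub A w) : IsCountable w A := by
  obtain ⟨f, hf, hf'⟩ := h.exists_fun (fun x y => x = y) A w fun x hx =>
    ⟨x, ⟨hA x hx, rfl⟩, fun y hy => hy.2.symm⟩
  refine ⟨f, hf, fun x x' y hx hx' => ?_⟩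
  exact ((hf' x y).1 hx).2.2.trans ((hf' x' y).1 hx').2.2.symm

/-- The image of a countable set is countable. -/
theorem IsCountable.image (h : IsZF M) {w C : M} (hw : IsOmega w) (hC : IsCountable w C)
    (r : M → M → Prop) [Dfn (fun v => r (v 0) (v 1))] {A : M}
    (hr : ∀ z, z ε A → ∃ c, c ε C ∧ r c z)
    (hr' : ∀ c z z', c ε C → z ε A → z' ε A → r c z → r c z' → z = z') : IsCountable w A := by
  have : ∀ a b : (ℕ → M) → M, ∀ [Trm a] [Trm b], Dfn (fun v => r (a v) (b v)) :=
    fun a b _ _ => Dfn.comp₂ a b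
  obtain ⟨e, he, hinj⟩ := hC
  -- No choice is needed: `z` is sent to the least code of a preimage of `z`.
  obtain ⟨f, hf, hf'⟩ := h.exists_fun (fun z n => (∃ c, c ε C ∧ PairMem e c n ∧ r c z) ∧
      ∀ m, m ε n → ¬ ∃ c, c ε C ∧ PairMem e c m ∧ r c z) A w fun z hz => by
    obtain ⟨c, hc, hcz⟩ := hr z hz
    obtain ⟨n, hn, hcn⟩ := he.exists_val hc
    obtain ⟨m, hm, hm', hmin⟩ := h.exists_min (fun n => ∃ c, c ε C ∧ PairMem e c n ∧ r c z) w
      ⟨n, hn, c, hc, hcn, hcz⟩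
    refine ⟨m, ⟨hm, hm', fun l hl => hmin l (hw.trans h hm hl) hl⟩, ?_⟩
    rintro l ⟨hl, hl', hlmin⟩
    rcases hw.trichotomy h hl hm with H | H | H
    · exact absurd hl' (hmin l hl H)
    · exact H
    · exact absurd hm' (hlmin m H)
  refine ⟨f, hf, fun z z' n hz hz' => ?_⟩
  obtain ⟨hzA, -, ⟨c, hc, hcn, hcz⟩, -⟩ := (hf' z n).1 hz
  obtain ⟨hzA', -, ⟨c', hc', hcn', hcz'⟩, -⟩ := (hf' z' n).1 hz'
  obtain rfl := hinj c c' n hcn hcn'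
  exact hr' c z z' hc hzA hzA' hcz hcz'

theorem IsOmegaOne.omega_sub {w k : M} (h : IsZF M) (hw : IsOmega w) (hk : IsOmegaOne w k) :
    Sub w k := by
  rcases (hw.isOrdinal h).trichotomy h hk.1 with H | rfl | H
  · exact hk.1.1 w H
  · exact Sub.refl _
  · exact absurd (IsCountable.of_sub h ((hw.isOrdinal h).1 k H)) hk.2.1

/-! ### Forms of `DC_{ω₁}` -/

/-- The relation in `DC_{ω₁}` is a set and sees only `g`, not the stage `a`. The stage is recovered
as the domain of `g`, and the relation is bounded using the power set of `k × S`. -/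
theorem DCOmegaOne.exists_fun (hDC : DCOmegaOne M) (h : IsZF M) {w k : M} (hw : IsOmega w)
    (hk : IsOmegaOne w k) (S : M) (P : M → M → M → Prop)
    [Dfn (fun v => P (v 0) (v 1) (v 2))]
    (hP : ∀ a g, a ε k → IsFun g a S → ∃ y, y ε S ∧ P a g y) :
    ∃ f, IsFun f k S ∧ ∀ a y, PairMem f a y →
      ∃ g, IsFun g a S ∧ (∀ b z, PairMem g b z ↔ b ε a ∧ PairMem f b z) ∧ P a g y := by
  have : ∀ a b c : (ℕ → M) → M, ∀ [Trm a] [Trm b] [Trm c],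
      Dfn (fun v => P (a v) (b v) (c v)) := fun a b c _ _ _ => Dfn.comp₃ a b c
  obtain ⟨C, hC⟩ := h.exists_prod k S
  obtain ⟨G, hG⟩ := h.powerset C
  obtain ⟨R, -, hR⟩ := h.exists_rel (fun g y => ∃ a, a ε k ∧ IsFun g a S ∧ P a g y) G S
  obtain ⟨f, hf, hf'⟩ := hDC w k S R hw hk fun a g ha hg => by
    obtain ⟨y, hy, hPy⟩ := hP a g ha hg
    refine ⟨y, hy, (hR g y).2 ⟨(hG g).2 fun p hp => ?_, hy, a, ha, hg, hPy⟩⟩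
    obtain ⟨x, z, hx, hz, hxz⟩ := hg.1 p hp
    exact (hC p).2 ⟨x, z, hk.1.1 a ha x hx, hz, hxz⟩
  refine ⟨f, hf, fun a y hay => ?_⟩
  have ha := (hf.mem hay).1
  obtain ⟨g, hg, hgf, hg'⟩ := hf.restrict h (hk.1.1 a ha)
  obtain ⟨-, -, a', -, hga', hPy⟩ := (hR g y).1 (hf' a g y ha hg hgf hay)
  have : a = a' := h.extensionality _ _ fun z => by
    constructor
    · intro hz
      obtain ⟨y, -, hy⟩ := hg.exists_val hz
      exact (hga'.mem hy).1
    · intro hz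
      obtain ⟨y, -, hy⟩ := hga'.exists_val hz
      exact (hg.mem hy).1
  subst this
  exact ⟨g, hg, hg', hPy⟩

/-- Countable choice. -/
theorem DCOmegaOne.countable_choice (hDC : DCOmegaOne M) (h : IsZF M) {w k : M} (hw : IsOmega w)
    (hk : IsOmegaOne w k) (S : M) (P : M → M → Prop) [Dfn (fun v => P (v 0) (v 1))]
    (hP : ∀ n, n ε w → ∃ y, y ε S ∧ P n y) :
    ∃ f, IsFun f w S ∧ ∀ n y, PairMem f n y → P n y := by
  have : ∀ a b : (ℕ → M) → M, ∀ [Trm a] [Trm b], Dfn (fun v => P (a v) (b v)) :=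
    fun a b _ _ => Dfn.comp₂ a b
  obtain ⟨e, he⟩ := h.exists_empty
  obtain ⟨y₀, hy₀, -⟩ := hP e (hw.zero_mem h he)
  -- The recursion runs through all of `ω₁`; from stage `ω` on, the value is unconstrained and `y₀`
  -- serves as a default.
  obtain ⟨f, hf, hf'⟩ := hDC.exists_fun h hw hk S (fun a _ y => a ε w → P a y) fun a _ _ _ => by
    by_cases ha : a ε w
    · obtain ⟨y, hy, hay⟩ := hP a ha
      exact ⟨y, hy, fun _ => hay⟩
    · exact ⟨y₀, hy₀, fun H => absurd H ha⟩
  obtain ⟨g, hg, hgf, hg'⟩ := hf.restrict h (hk.omega_sub h hw)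
  refine ⟨g, hg, fun n y hny => ?_⟩
  obtain ⟨-, -, -, hP⟩ := hf' n y (hgf.pairMem hny)
  exact hP (hg.mem hny).1

end Basics

/-! ### Baire category for the forcing notion -/

section Meager

variable {M : Type*} [setLang.Structure M]

/-! ### The ideal in terms of increasing sequences of small sets -/

/-- The standing hypotheses: `ZF + DC_{ω₁}` holds in `M`, and `Q` is a forcing notion as above. -/
structure ForcingContext (w k Q : M) : Prop where
  zf : IsZF M
  dc : DCOmegaOne M
  omega : IsOmega w
  omegaOne : IsOmegaOne w k
  forcing : IsSuslinCCCTreeForcing w k Q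

/-- Every condition has an extension none of whose branches satisfies `P`. -/
def IsSmallPred (w Q : M) (P : M → Prop) : Prop :=
  ∀ p, p ε Q → ∃ q, q ε Q ∧ Sub q p ∧ ∀ x, P x → ¬ IsBranch w q x

/-- The sections `Z_n`, `n ∈ ω`, of `Z` are small and increasing. -/
def IsSmallSeq (w Q Z : M) : Prop :=
  (∀ n, n ε w → IsSmallPred w Q fun x => PairMem Z n x) ∧
    ∀ m n x, n ε w → m ε n → PairMem Z m x → PairMem Z n x

/-- The reals satisfying `P` are covered by an increasing sequence of small sets. -/
def IsMeagerPred (w Q : M) (P : M → Prop) : Prop :=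
  ∃ Z, IsSmallSeq w Q Z ∧ ∀ x, IsReal w x → P x → ∃ n, n ε w ∧ PairMem Z n x

instance {w Q : M} {a : (ℕ → M) → M} [Trm a] : Dfn (fun v => IsSmallSeq w Q (a v)) :=
  have : Dfn (fun v : ℕ → M => IsSmallSeq w Q (v 0)) := by
    unfold IsSmallSeq IsSmallPred; infer_instance
  Dfn.comp₁ a

instance {w Q : M} {T : (ℕ → M) → M → Prop} [hT : Dfn (fun v => T (fun i => v (i + 1)) (v 0))] :
    Dfn (fun v => IsMeagerPred w Q (T v)) := by
  -- In `IsMeagerPred` the real is quantified under `Z`. The renaming therefore skips variable `1`,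
  -- on which `T` does not depend.
  have : Dfn (fun v => T (fun i => v (i + 2)) (v 0)) :=
    Dfn.comp (P := fun v => T (fun i => v (i + 1)) (v 0))
      (fun i => Nat.casesOn i (fun v => v 0) (fun j v => v (j + 2)))
      (fun i => by cases i; exacts [Trm.var 0, Trm.var _])
  unfold IsMeagerPred
  infer_instance

theorem IsBranch.mono {w p q x : M} (h : Sub q p) (hx : IsBranch w q x) : IsBranch w p x :=
  ⟨hx.1, fun s hs hsx => h s (hx.2 s hs hsx)⟩

theorem IsSmallPred.mono {w Q : M} {P R : M → Prop} (hP : IsSmallPred w Q P)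
    (hRP : ∀ x, R x → P x) : IsSmallPred w Q R := fun p hp =>
  let ⟨q, hq, hqp, hqx⟩ := hP p hp
  ⟨q, hq, hqp, fun x hx => hqx x (hRP x hx)⟩

theorem IsSmallPred.or {w Q : M} {P R : M → Prop} (hP : IsSmallPred w Q P)
    (hR : IsSmallPred w Q R) : IsSmallPred w Q (fun x => P x ∨ R x) := by
  intro p hp
  obtain ⟨q, hq, hqp, hqx⟩ := hP p hp
  obtain ⟨r, hr, hrq, hrx⟩ := hR q hq
  exact ⟨r, hr, hrq.trans hqp, fun x hx hxr =>
    hx.elim (fun H => hqx x H (hxr.mono hrq)) (fun H => hrx x H hxr)⟩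

theorem IsSmallPred.of_false {w Q : M} {P : M → Prop} (hP : ∀ x, ¬ P x) : IsSmallPred w Q P :=
  fun p hp => ⟨p, hp, Sub.refl p, fun x hx => absurd hx (hP x)⟩

theorem IsMeagerPred.mono {w Q : M} {P R : M → Prop} (hP : IsMeagerPred w Q P)
    (hRP : ∀ x, IsReal w x → R x → P x) : IsMeagerPred w Q R :=
  let ⟨Z, hZ, hZP⟩ := hP
  ⟨Z, hZ, fun x hx hRx => hZP x hx (hRP x hx hRx)⟩

theorem IsZF.exists_reals (h : IsZF M) (w : M) : ∃ R, ∀ x, x ε R ↔ IsReal w x := by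
  obtain ⟨C, hC⟩ := h.exists_prod w w
  obtain ⟨V, hV⟩ := h.powerset C
  obtain ⟨R, hR⟩ := h.sep (fun x => IsReal w x) V
  exact ⟨R, fun x => (hR x).trans
    (and_iff_right_of_imp fun hx => (hV x).2 fun p hp => (hC p).2 (hx.1 p hp))⟩

/-- Definable families of sets of reals, indexed by `ω`, are sets. -/
theorem IsZF.exists_realSeq (h : IsZF M) (w : M) (T : M → M → Prop)
    [Dfn (fun v => T (v 0) (v 1))] :
    ∃ Z, ∀ n x, PairMem Z n x ↔ n ε w ∧ IsReal w x ∧ T n x := by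
  obtain ⟨R, hR⟩ := h.exists_reals w
  obtain ⟨Z, -, hZ⟩ := h.exists_rel T w R
  exact ⟨Z, fun n x => by rw [hZ, hR]⟩

theorem IsSmallPred.isMeagerPred (h : IsZF M) {w Q : M} (hw : IsOmega w) {P : M → Prop}
    [Dfn (fun v => P (v 0))] (hP : IsSmallPred w Q P) : IsMeagerPred w Q P := by
  have : ∀ a : (ℕ → M) → M, ∀ [Trm a], Dfn (fun v => P (a v)) := fun a _ => Dfn.comp₁ a
  obtain ⟨Z, hZ⟩ := h.exists_realSeq w (fun _ x => P x)
  refine ⟨Z, ⟨fun n _ => hP.mono fun x hx => ((hZ n x).1 hx).2.2, fun m n x hn _ hx => ?_⟩,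
    fun x hx hPx => ?_⟩
  · exact (hZ n x).2 ⟨hn, ((hZ m x).1 hx).2⟩
  · obtain ⟨e, he⟩ := h.exists_empty
    exact ⟨e, hw.zero_mem h he, (hZ e x).2 ⟨hw.zero_mem h he, hx, hPx⟩⟩

theorem IsMeagerPred.or (h : IsZF M) {w Q : M} {P R : M → Prop}
    (hP : IsMeagerPred w Q P) (hR : IsMeagerPred w Q R) :
    IsMeagerPred w Q (fun x => P x ∨ R x) := by
  obtain ⟨Y, hY, hYP⟩ := hP
  obtain ⟨Z, hZ, hZR⟩ := hR
  obtain ⟨U, hU⟩ := h.exists_realSeq w (fun n x => PairMem Y n x ∨ PairMem Z n x)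
  refine ⟨U, ⟨fun n hn => ((hY.1 n hn).or (hZ.1 n hn)).mono fun x hx => ((hU n x).1 hx).2.2,
    fun m n x hn hmn hx => ?_⟩, fun x hx hPR => ?_⟩
  · obtain ⟨-, hx, H⟩ := (hU m x).1 hx
    exact (hU n x).2 ⟨hn, hx, H.imp (hY.2 m n x hn hmn) (hZ.2 m n x hn hmn)⟩
  · rcases hPR with H | H
    · obtain ⟨n, hn, hnx⟩ := hYP x hx H
      exact ⟨n, hn, (hU n x).2 ⟨hn, hx, Or.inl hnx⟩⟩
    · obtain ⟨n, hn, hnx⟩ := hZR x hx H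
      exact ⟨n, hn, (hU n x).2 ⟨hn, hx, Or.inr hnx⟩⟩

/-- A countable union of meager sets is meager. -/
theorem ForcingContext.isMeagerPred_iUnion {w k Q : M} (c : ForcingContext w k Q) {C : M}
    (hC : IsCountable w C) (T : M → M → Prop) [Dfn (fun v => T (v 0) (v 1))]
    (hT : ∀ i, i ε C → IsMeagerPred w Q (T i)) :
    IsMeagerPred w Q (fun x => ∃ i, i ε C ∧ T i x) := by
  have : ∀ a b : (ℕ → M) → M, ∀ [Trm a] [Trm b], Dfn (fun v => T (a v) (b v)) :=
    fun a b _ _ => Dfn.comp₂ a b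
  have h := c.zf
  have hw := c.omega
  obtain ⟨e, he, hinj⟩ := hC
  obtain ⟨R, hR⟩ := h.exists_reals w
  obtain ⟨W, hW⟩ := h.exists_prod w R
  obtain ⟨S, hS⟩ := h.powerset W
  -- For each code `n`, choose a covering sequence for the set coded by `n`, cut down to reals so
  -- that the candidates form a set. A number that codes nothing gets the empty sequence.
  obtain ⟨f, hf, hf'⟩ := c.dc.countable_choice h hw c.omegaOne S
    (fun n Z => IsSmallSeq w Q Z ∧ ∀ i, PairMem e i n → ∀ x, IsReal w x → T i x →
      ∃ m, m ε w ∧ PairMem Z m x) fun n hn => by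
    by_cases hi : ∃ i, PairMem e i n
    · obtain ⟨i, hi⟩ := hi
      obtain ⟨Z, hZ, hZT⟩ := hT i (he.mem hi).1
      obtain ⟨Z', hZ'R, hZ'⟩ := h.exists_rel (fun n x => PairMem Z n x) w R
      refine ⟨Z', (hS Z').2 fun p hp => (hW p).2 (hZ'R p hp),
        ⟨fun m hm => (hZ.1 m hm).mono fun x hx => ((hZ' m x).1 hx).2.2, ?_⟩, ?_⟩
      · intro m l x hl hml hx
        obtain ⟨-, hxR, hx⟩ := (hZ' m x).1 hx
        exact (hZ' l x).2 ⟨hl, hxR, hZ.2 m l x hl hml hx⟩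
      · intro j hj x hx hTx
        obtain rfl := hinj i j n hi hj
        obtain ⟨m, hm, hmx⟩ := hZT x hx hTx
        exact ⟨m, hm, (hZ' m x).2 ⟨hm, (hR x).2 hx, hmx⟩⟩
    · obtain ⟨Z, hZ⟩ := h.exists_empty
      have hZ' : ∀ m x, ¬ PairMem Z m x := fun m x ⟨p, _, hp⟩ => hZ p hp
      exact ⟨Z, (hS Z).2 fun p hp => absurd hp (hZ p),
        ⟨fun m _ => .of_false (hZ' m), fun m l x _ _ hx => absurd hx (hZ' m x)⟩,
        fun i hin => absurd ⟨i, hin⟩ hi⟩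
  -- Diagonal union: level `n` collects level `n` of the first `n` sequences. It is small as a
  -- finite union, and monotonicity ensures that every point is eventually caught.
  obtain ⟨U, hU⟩ := h.exists_realSeq w
    (fun n x => ∃ i, i ε n ∧ ∃ Z, PairMem f i Z ∧ PairMem Z n x)
  have hom := hw.isOrdinal h
  refine ⟨U, ⟨fun n hn => ?_, ?_⟩, ?_⟩
  · have key : ∀ m, m ε w → Sub m n →
        ∀ p, p ε Q → ∃ q, q ε Q ∧ Sub q p ∧
          ∀ x, (∃ i, i ε m ∧ ∃ Z, PairMem f i Z ∧ PairMem Z n x) → ¬ IsBranch w q x := by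
      intro m hm
      refine hw.induction h (fun m => Sub m n →
        ∀ p, p ε Q → ∃ q, q ε Q ∧ Sub q p ∧
          ∀ x, (∃ i, i ε m ∧ ∃ Z, PairMem f i Z ∧ PairMem Z n x) → ¬ IsBranch w q x) ?_ ?_ hm
      · intro e he _
        exact IsSmallPred.of_false fun x ⟨i, hi, _⟩ => he i hi
      · intro m s hm ih hs hsn
        obtain ⟨Z, -, hZ⟩ := hf.exists_val hm
        refine (IsSmallPred.or (ih fun i hi => hsn i ((hs i).2 (Or.inl hi)))
          ((hf' m Z hZ).1.1 n hn)).mono ?_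
        rintro x ⟨i, hi, Y, hY, hx⟩
        rcases (hs i).1 hi with hi | rfl
        · exact Or.inl ⟨i, hi, Y, hY, hx⟩
        · rw [hf.eq hY hZ] at hx
          exact Or.inr hx
    exact IsSmallPred.mono (key n hn (Sub.refl n)) fun x hx => ((hU n x).1 hx).2.2
  · intro m n x hn hmn hx
    obtain ⟨-, hxr, i, him, Z, hiZ, hx⟩ := (hU m x).1 hx
    exact (hU n x).2 ⟨hn, hxr, i, (hom.of_mem hn).1 m hmn i him, Z, hiZ,
      (hf' i Z hiZ).1.2 m n x hn hmn hx⟩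
  · rintro x hx ⟨i, hi, hTx⟩
    obtain ⟨n, hn, hin⟩ := he.exists_val hi
    obtain ⟨Z, -, hZ⟩ := hf.exists_val hn
    obtain ⟨m, hm, hmx⟩ := (hf' n Z hZ).2 i hin x hx hTx
    obtain ⟨l, hl, hnl, hml⟩ := hw.exists_mem_mem h hn hm
    exact ⟨l, hl, (hU l x).2 ⟨hl, hx, n, hnl, Z, hZ, (hf' n Z hZ).1.2 m l x hl hml hmx⟩⟩

/-- The meager sets of reals form a set that contains the small sets and is closed under countable
unions, so it is a legitimate `J`. Conversely, a meager `X` is the countable union of the small sets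
`X ∩ Z_n`. -/
theorem ForcingContext.inIdeal_iff {w k Q : M} (c : ForcingContext w k Q) (X : M) :
    InIdeal w Q X ↔ (∀ x, x ε X → IsReal w x) ∧ IsMeagerPred w Q (fun x => x ε X) := by
  have h := c.zf
  obtain ⟨R, hR⟩ := h.exists_reals w
  obtain ⟨V, hV⟩ := h.powerset R
  have hV' : ∀ X, X ε V ↔ ∀ x, x ε X → IsReal w x := fun X =>
    (hV X).trans (forall_congr' fun x => imp_congr_right fun _ => hR x)
  constructor
  · intro hX
    obtain ⟨J, hJ⟩ := h.sep (fun X => IsMeagerPred w Q (fun x => x ε X)) V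
    rw [← hV', ← hJ]
    refine hX J (fun Y hY => (hJ Y).2 ⟨(hV' Y).2 hY.1, ?_⟩) fun F U hF hFJ hU => ?_
    · exact IsSmallPred.isMeagerPred h c.omega hY.2
    · refine (hJ U).2 ⟨(hV' U).2 fun x hx => ?_, ?_⟩
      · obtain ⟨Y, hY, hxY⟩ := (hU x).1 hx
        exact (hV' Y).1 ((hJ Y).1 (hFJ Y hY)).1 x hxY
      · exact (c.isMeagerPred_iUnion hF (fun Y x => x ε Y) fun Y hY =>
          ((hJ Y).1 (hFJ Y hY)).2).mono fun x _ hx => (hU x).1 hx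
  · rintro ⟨hXr, Z, hZ, hXZ⟩ J hJs hJu
    obtain ⟨F, hF⟩ := h.sep
      (fun Y => ∃ n, n ε w ∧ ∀ x, x ε Y ↔ x ε X ∧ PairMem Z n x) V
    refine hJu F X ?_ ?_ ?_
    · refine (IsCountable.of_sub h (Sub.refl w)).image h c.omega
        (fun n Y => ∀ x, x ε Y ↔ x ε X ∧ PairMem Z n x) (fun Y hY => ((hF Y).1 hY).2) ?_
      intro n Y Y' _ _ _ hY hY'
      exact h.extensionality _ _ fun x => (hY x).trans (hY' x).symm
    · intro Y hY
      obtain ⟨hYV, n, hn, hYn⟩ := (hF Y).1 hY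
      exact hJs Y ⟨(hV' Y).1 hYV, (hZ.1 n hn).mono fun x hx => ((hYn x).1 hx).2⟩
    · intro x
      constructor
      · intro hx
        obtain ⟨n, hn, hxn⟩ := hXZ x (hXr x hx) hx
        obtain ⟨Y, hY⟩ := h.sep (fun x => PairMem Z n x) X
        exact ⟨Y, (hF Y).2 ⟨(hV' Y).2 fun y hy => hXr y ((hY y).1 hy).1, n, hn, hY⟩,
          (hY x).2 ⟨hx, hxn⟩⟩
      · rintro ⟨Y, hY, hx⟩
        obtain ⟨-, n, -, hYn⟩ := (hF Y).1 hY
        exact ((hYn x).1 hx).1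

/-! ### Conditions -/

/-- Every set of conditions has a countable subset that is predense in it. -/
theorem ForcingContext.exists_countable_predense {w k Q : M} (c : ForcingContext w k Q) {S : M}
    (hS : Sub S Q) :
    ∃ E, Sub E S ∧ IsCountable w E ∧ ∀ y, y ε S → ∃ e, e ε E ∧ Compat Q y e := by
  by_contra hE
  push Not at hE
  have h := c.zf
  -- If no countable subset is predense, a condition incompatible with all earlier ones exists at
  -- each stage, because the range of `g` is countable. The recursion yields an `ω₁`-antichain.
  obtain ⟨f, hf, hf'⟩ := c.dc.exists_fun h c.omega c.omegaOne S
    (fun _ g y => ∀ b z, PairMem g b z → ¬ Compat Q y z) fun a g ha hg => by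
    obtain ⟨E, hEg⟩ := h.sep (fun z => ∃ b, PairMem g b z) S
    obtain ⟨y, hy, hyE⟩ := hE E (fun z hz => ((hEg z).1 hz).1) <| by
      refine (c.omegaOne.2.2 a ha).image h c.omega (fun b z => PairMem g b z) ?_ ?_
      · intro z hz
        obtain ⟨-, b, hb⟩ := (hEg z).1 hz
        exact ⟨b, (hg.mem hb).1, hb⟩
      · intro b z z' _ _ _ hz hz'
        exact hg.eq hz hz'
    exact ⟨y, hy, fun b z hbz => hyE z ((hEg z).2 ⟨(hg.mem hbz).2, b, hbz⟩)⟩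
  have key : ∀ a b p q, b ε a → PairMem f a p → PairMem f b q → ¬ Compat Q p q := by
    intro a b p q hba hp hq
    obtain ⟨g, -, hg, H⟩ := hf' a p hp
    exact H b q ((hg b q).2 ⟨hba, hq⟩)
  refine c.forcing.ccc ⟨f, ⟨fun p hp => ?_, hf.2⟩, fun a b p q hab hp hq hpq => ?_⟩
  · obtain ⟨x, y, hx, hy, hxy⟩ := hf.1 p hp
    exact ⟨x, y, hx, hS y hy, hxy⟩
  · rcases (c.omegaOne.1.of_mem (hf.mem hp).1).trichotomy h
      (c.omegaOne.1.of_mem (hf.mem hq).1) with H | H | H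
    · obtain ⟨r, hr, hrp, hrq⟩ := hpq
      exact key b a q p H hq hp ⟨r, hr, hrq, hrp⟩
    · exact hab H
    · exact key a b p q H hp hq hpq

theorem ForcingContext.trunk_isSeq {w k Q q s : M} (c : ForcingContext w k Q) (hq : q ε Q)
    (hs : IsTrunk q s) : IsSeq w s :=
  (c.forcing.perfect q hq).2.1 s hs.1.1

/-- The initial segment of `x` of the length of `s` is a node comparable with `s`, hence equal to
`s`. -/
theorem ForcingContext.trunk_sub_branch {w k Q q s x : M} (c : ForcingContext w k Q) (hq : q ε Q)
    (hs : IsTrunk q s) (hx : IsBranch w q x) : Sub s x := by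
  have h := c.zf
  obtain ⟨n, hn, hsn⟩ := c.trunk_isSeq hq hs
  obtain ⟨t, ht, htx, ht'⟩ := hx.1.restrict h ((c.omega.isOrdinal h).1 n hn)
  rcases hs.1.2 t (hx.2 t ⟨n, hn, ht⟩ htx) with H | H
  · exact H.trans htx
  · refine hsn.sub h fun i y hiy => ?_
    obtain ⟨y', -, hiy'⟩ := ht.exists_val (hsn.mem hiy).1
    rw [hsn.eq hiy (H.pairMem hiy')]
    exact htx.pairMem hiy'

/-- If every `r` below `q` shared a branch with `p`, the trunk of `r`, an initial segment of that
branch, would lie in `p`. The second clause of `HasGenericReal` would then make `p` and `q`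
compatible. -/
theorem ForcingContext.exists_disjoint {w k Q p q : M} (c : ForcingContext w k Q) (hp : p ε Q)
    (hq : q ε Q) (hpq : ¬ Compat Q p q) :
    ∃ r, r ε Q ∧ Sub r q ∧ ∀ x, IsBranch w r x → ¬ IsBranch w p x := by
  by_contra H
  push Not at H
  refine hpq (c.forcing.generic.2 p q hp hq fun r s hr hrq hs => ?_)
  obtain ⟨x, hxr, hxp⟩ := H r hr hrq
  exact hxp.2 s (c.trunk_isSeq hr hs) (c.trunk_sub_branch hr hs hxr)

/-- The Banach category theorem: a set that is meager below densely many conditions is meager. -/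
theorem ForcingContext.isMeagerPred_of_dense {w k Q : M} (c : ForcingContext w k Q)
    (T : M → Prop) [Dfn (fun v => T (v 0))]
    (hT : ∀ p, p ε Q → ∃ q, q ε Q ∧ Sub q p ∧ IsMeagerPred w Q (fun x => IsBranch w q x ∧ T x)) :
    IsMeagerPred w Q T := by
  have : ∀ a : (ℕ → M) → M, ∀ [Trm a], Dfn (fun v => T (a v)) := fun a _ => Dfn.comp₁ a
  have h := c.zf
  obtain ⟨S, hS⟩ := h.sep (fun q => IsMeagerPred w Q (fun x => IsBranch w q x ∧ T x)) Q
  obtain ⟨E, hES, hE, hEd⟩ := c.exists_countable_predense fun q hq => ((hS q).1 hq).1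
  have h1 := c.isMeagerPred_iUnion hE (fun q x => IsBranch w q x ∧ T x) fun q hq =>
    ((hS q).1 (hES q hq)).2
  -- The part of `T` outside all `lim e`, `e ∈ E`, is even small: by predensity, each condition has
  -- an extension lying below some `e`.
  have h2 : IsMeagerPred w Q (fun x => T x ∧ ∀ q, q ε E → ¬ IsBranch w q x) := by
    refine IsSmallPred.isMeagerPred h c.omega fun p hp => ?_
    obtain ⟨q, hq, hqp, hqT⟩ := hT p hp
    obtain ⟨e, he, r, hr, hrq, hre⟩ := hEd q ((hS q).2 ⟨hq, hqT⟩)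
    exact ⟨r, hr, hrq.trans hqp, fun x hx hxr => hx.2 e he (hxr.mono hre)⟩
  refine (h1.or h h2).mono fun x _ hx => ?_
  by_cases H : ∃ q, q ε E ∧ IsBranch w q x
  · obtain ⟨q, hq, hqx⟩ := H
    exact Or.inl ⟨q, hq, hqx, hx⟩
  · exact Or.inr ⟨hx, fun q hq hqx => H ⟨q, hq, hqx⟩⟩

/-- The Baire category theorem: the set of branches of a condition is not meager. -/
theorem ForcingContext.not_isMeagerPred_branch {w k Q r : M} (c : ForcingContext w k Q)
    (hr : r ε Q) : ¬ IsMeagerPred w Q (fun x => IsBranch w r x) := by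
  rintro ⟨Z, hZ, hrZ⟩
  have h := c.zf
  have hw := c.omega
  have hom := hw.isOrdinal h
  -- Build a decreasing sequence below `r` whose `n`-th member avoids `Z_n` and has a trunk longer
  -- than `n`. `DC_{ω₁}` demands a successor for every `g`, so descent is required only if the
  -- values of `g` have a common lower bound; `lower` shows that this holds at all finite stages.
  obtain ⟨f, hf, hf'⟩ := c.dc.exists_fun h hw c.omegaOne Q
    (fun a g y => a ε w →
      ((∃ z, z ε Q ∧ Sub z r ∧ ∀ b u, PairMem g b u → Sub z u) →
        Sub y r ∧ ∀ b u, PairMem g b u → Sub y u) ∧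
      (∀ x, PairMem Z a x → ¬ IsBranch w y x) ∧ ∃ s v, IsTrunk y s ∧ PairMem s a v)
    fun a g _ _ => by
    by_cases ha : a ε w
    · have hz : ∃ z, z ε Q ∧ ((∃ z, z ε Q ∧ Sub z r ∧ ∀ b u, PairMem g b u → Sub z u) →
          Sub z r ∧ ∀ b u, PairMem g b u → Sub z u) := by
        by_cases H : ∃ z, z ε Q ∧ Sub z r ∧ ∀ b u, PairMem g b u → Sub z u
        · obtain ⟨z, hz, hz'⟩ := H
          exact ⟨z, hz, fun _ => hz'⟩
        · exact ⟨r, hr, fun H' => absurd H' H⟩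
      obtain ⟨z, hz, hz'⟩ := hz
      obtain ⟨y, hy, hyz, hyx⟩ := hZ.1 a ha z hz
      obtain ⟨q, s, hq, hqy, hs, v, hv⟩ := c.forcing.generic.1 y a hy ha
      have hqz := hqy.trans hyz
      exact ⟨q, hq, fun _ => ⟨fun H => ⟨hqz.trans (hz' H).1,
        fun b u hbu => hqz.trans ((hz' H).2 b u hbu)⟩,
        fun x hx hxq => hyx x hx (hxq.mono hqy), s, v, hs, hv⟩⟩
    · exact ⟨r, hr, fun H => absurd H ha⟩
  have hwk := c.omegaOne.omega_sub h hw
  have step : ∀ n q, n ε w → PairMem f n q →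
      (∃ z, z ε Q ∧ Sub z r ∧ ∀ b u, b ε n → PairMem f b u → Sub z u) →
        Sub q r ∧ ∀ b u, b ε n → PairMem f b u → Sub q u := by
    rintro n q hn hq ⟨z, hz, hzr, hzu⟩
    obtain ⟨g, -, hg, H⟩ := hf' n q hq
    obtain ⟨hqr, hqu⟩ := (H hn).1
      ⟨z, hz, hzr, fun b u hbu => hzu b u ((hg b u).1 hbu).1 ((hg b u).1 hbu).2⟩
    exact ⟨hqr, fun b u hb hbu => hqu b u ((hg b u).2 ⟨hb, hbu⟩)⟩
  have lower : ∀ n, n ε w →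
      ∃ z, z ε Q ∧ Sub z r ∧ ∀ b u, b ε n → PairMem f b u → Sub z u := by
    intro n hn
    refine hw.induction h
      (fun n => ∃ z, z ε Q ∧ Sub z r ∧ ∀ b u, b ε n → PairMem f b u → Sub z u) ?_ ?_ hn
    · exact fun e he => ⟨r, hr, Sub.refl r, fun b u hb => absurd hb (he b)⟩
    · intro n s hn ih hs
      obtain ⟨q, hqQ, hq⟩ := hf.exists_val (hwk n hn)
      obtain ⟨hqr, hqu⟩ := step n q hn hq ih
      refine ⟨q, hqQ, hqr, fun b u hb hbu => ?_⟩
      rcases (hs b).1 hb with hb | rfl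
      · exact hqu b u hb hbu
      · rw [hf.eq hq hbu]
        exact Sub.refl u
  have decr : ∀ n q, n ε w → PairMem f n q →
      Sub q r ∧ ∀ b u, b ε n → PairMem f b u → Sub q u :=
    fun n q hn hq => step n q hn hq (lower n hn)
  have hcomp : ∀ m n p q s t, m ε n → n ε w → PairMem f m p → PairMem f n q → IsTrunk p s →
      IsTrunk q t → Sub s t ∨ Sub t s := fun m n p q s t hmn hn hp hq hs ht =>
    hs.1.2 t ((decr n q hn hq).2 m p hmn hp t ht.1.1)
  have hcomp' : ∀ m n p q s t, m ε w → n ε w → PairMem f m p → PairMem f n q → IsTrunk p s →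
      IsTrunk q t → Sub s t ∨ Sub t s := by
    intro m n p q s t hm hn hp hq hs ht
    rcases hw.trichotomy h hm hn with H | rfl | H
    · exact hcomp m n p q s t H hn hp hq hs ht
    · obtain rfl := hf.eq hp hq
      exact hs.1.2 t ht.1.1
    · exact (hcomp n m q p t s H hm hq hp ht hs).symm
  have hlong : ∀ n, n ε w → ∃ q s d, q ε Q ∧ PairMem f n q ∧ IsTrunk q s ∧ IsFun s d w ∧
      d ε w ∧ n ε d := by
    intro n hn
    obtain ⟨q, hqQ, hq⟩ := hf.exists_val (hwk n hn)
    obtain ⟨g, -, -, H⟩ := hf' n q hq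
    obtain ⟨s, v, hs, hv⟩ := (H hn).2.2
    obtain ⟨d, hd, hsd⟩ := c.trunk_isSeq hqQ hs
    exact ⟨q, s, d, hqQ, hq, hs, hsd, hd, (hsd.mem hv).1⟩
  -- `x` is the union of the trunks, which are pairwise comparable and arbitrarily long.
  obtain ⟨x, hx, hx'⟩ := h.exists_fun
    (fun i y => ∃ n q s, n ε w ∧ PairMem f n q ∧ IsTrunk q s ∧ PairMem s i y) w w fun i hi => by
    obtain ⟨q, s, d, -, hq, hs, hsd, -, hid⟩ := hlong i hi
    obtain ⟨y, hy, hiy⟩ := hsd.exists_val hid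
    refine ⟨y, ⟨hy, i, q, s, hi, hq, hs, hiy⟩, ?_⟩
    rintro y' ⟨-, n, q', s', hn, hq', hs', hiy'⟩
    obtain ⟨d', -, hsd'⟩ := c.trunk_isSeq (hf.mem hq').2 hs'
    rcases hcomp' i n q q' s s' hi hn hq hq' hs hs' with H | H
    · exact hsd'.eq hiy' (H.pairMem hiy)
    · exact hsd.eq (H.pairMem hiy') hiy
  have hbr : ∀ n q, n ε w → PairMem f n q → IsBranch w q x := by
    intro n q hn hq
    refine ⟨hx, ?_⟩
    rintro s ⟨a, ha, hsa⟩ hsx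
    -- The trunk at a stage `l` beyond both `n` and the length of `s` extends `s` and is a node of
    -- `q`.
    obtain ⟨l, hl, hnl, hal⟩ := hw.exists_mem_mem h hn ha
    obtain ⟨p, t, d, -, hp, ht, htd, hd, hld⟩ := hlong l hl
    refine (c.forcing.perfect q (hf.mem hq).2).2.2.1 s t
      ((decr l p hl hp).2 n q hnl hq t ht.1.1) ⟨a, ha, hsa⟩ (hsa.sub h fun i y hiy => ?_)
    have hil : i ε l := (hom.of_mem hl).1 a hal i (hsa.mem hiy).1
    obtain ⟨y', hy', hiy'⟩ := htd.exists_val ((hom.of_mem hd).1 l hld i hil)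
    rw [hx.eq (hsx.pairMem hiy)
      ((hx' i y').2 ⟨hw.trans h hl hil, hy', l, p, t, hl, hp, ht, hiy'⟩)]
    exact hiy'
  have hxr : IsBranch w r x := by
    obtain ⟨e, he⟩ := h.exists_empty
    have he' := hw.zero_mem h he
    obtain ⟨q, -, hq⟩ := hf.exists_val (hwk e he')
    exact (hbr e q he' hq).mono (decr e q he' hq).1
  obtain ⟨n, hn, hnx⟩ := hrZ x hx hxr
  obtain ⟨q, -, hq⟩ := hf.exists_val (hwk n hn)
  obtain ⟨g, -, -, H⟩ := hf' n q hq
  exact (H hn).2.1 x hnx (hbr n q hn hq)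

end Meager

/-! ### Baire property of Borel sets and the chain condition -/

section BorelQuotient

variable {M : Type*} [setLang.Structure M]

/-! ### Borel sets -/

/-- Borel sets have the Baire property: every condition has an extension `q` such that `B` or its
complement is meager in `lim q`. -/
theorem ForcingContext.borel_baire {w k Q B : M} (c : ForcingContext w k Q) (hB : IsBorel w B) :
    (∀ x, x ε B → IsReal w x) ∧ ∀ p, p ε Q → ∃ q, q ε Q ∧ Sub q p ∧
      (IsMeagerPred w Q (fun x => IsBranch w q x ∧ x ε B) ∨
        IsMeagerPred w Q (fun x => IsBranch w q x ∧ ¬ x ε B)) := by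
  have h := c.zf
  obtain ⟨R, hR⟩ := h.exists_reals w
  obtain ⟨V, hV⟩ := h.powerset R
  have hV' : ∀ X, X ε V ↔ ∀ x, x ε X → IsReal w x := fun X =>
    (hV X).trans (forall_congr' fun x => imp_congr_right fun _ => hR x)
  -- Passing through the definable predicate `x ≠ x` avoids a definability condition on `P`.
  have meager_false : ∀ P : M → Prop, (∀ x, ¬ P x) → IsMeagerPred w Q P := fun P hP =>
    IsMeagerPred.mono (P := fun x => x ≠ x)
      (IsSmallPred.isMeagerPred h c.omega (.of_false fun x hx => hx rfl))
      fun x _ hx => absurd hx (hP x)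
  obtain ⟨S, hS⟩ := h.sep (fun B => ∀ p, p ε Q → ∃ q, q ε Q ∧ Sub q p ∧
      (IsMeagerPred w Q (fun x => IsBranch w q x ∧ x ε B) ∨
        IsMeagerPred w Q (fun x => IsBranch w q x ∧ ¬ x ε B))) V
  rw [← hV', ← hS]
  refine hB S ?_ ?_ ?_
  · rintro s O ⟨n, hn, hs⟩ hO
    refine (hS O).2 ⟨(hV' O).2 fun x hx => ((hO x).1 hx).1, fun p hp => ?_⟩
    -- A trunk longer than `s` decides whether the branches of `q` extend `s`.
    obtain ⟨q, t, hq, hqp, ht, y, hy⟩ := c.forcing.generic.1 p n hp hn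
    refine ⟨q, hq, hqp, ?_⟩
    by_cases hst : Sub s t
    · refine Or.inr (meager_false _ fun x hx => hx.2 ((hO x).2 ⟨hx.1.1, ?_⟩))
      exact hst.trans (c.trunk_sub_branch hq ht hx.1)
    · refine Or.inl (meager_false _ fun x hx => hst (hs.sub h fun i j hij => ?_))
      obtain ⟨d, hd, htd⟩ := c.trunk_isSeq hq ht
      have hid : i ε d :=
        (((c.omega.isOrdinal h).of_mem hd).1 n (htd.mem hy).1) i (hs.mem hij).1
      obtain ⟨j', -, hij'⟩ := htd.exists_val hid
      rw [hx.1.1.eq (((hO x).1 hx.2).2.pairMem hij)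
        ((c.trunk_sub_branch hq ht hx.1).pairMem hij')]
      exact hij'
  · intro Y Z hY hZ
    refine (hS Z).2 ⟨(hV' Z).2 fun x hx => ((hZ x).1 hx).1, fun p hp => ?_⟩
    obtain ⟨q, hq, hqp, hqY⟩ := ((hS Y).1 hY).2 p hp
    refine ⟨q, hq, hqp, hqY.symm.imp (fun H => H.mono fun x _ hx => ?_)
      (fun H => H.mono fun x hxr hx => ?_)⟩
    · exact ⟨hx.1, ((hZ x).1 hx.2).2⟩
    · exact ⟨hx.1, by_contra fun hxY => hx.2 ((hZ x).2 ⟨hxr, hxY⟩)⟩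
  · intro F U hF hFS hU
    refine (hS U).2 ⟨(hV' U).2 fun x hx => ?_, fun p hp => ?_⟩
    · obtain ⟨Y, hY, hxY⟩ := (hU x).1 hx
      exact (hV' Y).1 ((hS Y).1 (hFS Y hY)).1 x hxY
    -- Either some `Y ∈ F` contains almost all of some `lim q` below `p`, and then so does `U`; or
    -- every `Y ∈ F` is meager in `lim p` by the Banach category theorem, and so is the countable
    -- union `U`.
    by_cases H : ∃ Y q, Y ε F ∧ q ε Q ∧ Sub q p ∧
        IsMeagerPred w Q (fun x => IsBranch w q x ∧ ¬ x ε Y)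
    · obtain ⟨Y, q, hY, hq, hqp, hqY⟩ := H
      exact ⟨q, hq, hqp, Or.inr (hqY.mono fun x _ hx =>
        ⟨hx.1, fun hxY => hx.2 ((hU x).2 ⟨Y, hY, hxY⟩)⟩)⟩
    · refine ⟨p, hp, Sub.refl p, Or.inl ?_⟩
      refine (c.isMeagerPred_iUnion hF (fun Y x => IsBranch w p x ∧ x ε Y) fun Y hY => ?_).mono
        fun x _ hx => ?_
      · refine c.isMeagerPred_of_dense (fun x => IsBranch w p x ∧ x ε Y) fun r hr => ?_
        -- Density must be checked below every `r`: work below a common extension with `p` if there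
        -- is one, and otherwise move to a condition disjoint from `lim p`.
        by_cases hpr : Compat Q p r
        · obtain ⟨r', hr', hr'p, hr'r⟩ := hpr
          obtain ⟨q, hq, hqr', hqY⟩ := ((hS Y).1 (hFS Y hY)).2 r' hr'
          refine ⟨q, hq, hqr'.trans hr'r, ?_⟩
          rcases hqY with hqY | hqY
          · exact hqY.mono fun x _ hx => ⟨hx.1, hx.2.2⟩
          · exact absurd ⟨Y, q, hY, hq, hqr'.trans hr'p, hqY⟩ H
        · obtain ⟨q, hq, hqr, hqp⟩ := c.exists_disjoint hp hr hpr
          exact ⟨q, hq, hqr, meager_false _ fun x hx => hqp x hx.1 hx.2.1⟩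
      · obtain ⟨Y, hY, hxY⟩ := (hU x).1 hx.2
        exact ⟨Y, hY, hx.1, hxY⟩

/-- A Borel set outside of the ideal contains almost all branches of some condition. -/
theorem ForcingContext.exists_condition {w k Q B : M} (c : ForcingContext w k Q)
    (hB : IsBorel w B) (hBI : ¬ InIdeal w Q B) :
    ∃ q, q ε Q ∧ IsMeagerPred w Q (fun x => IsBranch w q x ∧ ¬ x ε B) := by
  by_contra H
  obtain ⟨hBr, hBp⟩ := c.borel_baire hB
  refine hBI ((c.inIdeal_iff B).2 ⟨hBr, c.isMeagerPred_of_dense (fun x => x ε B) fun p hp => ?_⟩)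
  obtain ⟨q, hq, hqp, hqB | hqB⟩ := hBp p hp
  · exact ⟨q, hq, hqp, hqB⟩
  · exact absurd ⟨q, hq, hqB⟩ H

/-! ### The quotient algebra -/

theorem ForcingContext.exists_borel_mem {w k Q X : M} (c : ForcingContext w k Q)
    (hX : IsPosClass w Q X) : ∃ B, B ε X ∧ IsBorel w B ∧ ¬ InIdeal w Q B := by
  obtain ⟨⟨B, hB, hBX⟩, hpos⟩ := hX
  obtain ⟨e, he⟩ := c.zf.exists_empty
  have hBB : B ε X := (hBX B).2 ⟨hB, e, fun x => ⟨fun H => absurd H (he x), fun H =>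
      H.elim (fun H => absurd H.1 H.2) (fun H => absurd H.1 H.2)⟩,
    (c.inIdeal_iff e).2 ⟨fun x hx => absurd hx (he x), IsSmallPred.isMeagerPred c.zf c.omega
      (.of_false he)⟩⟩
  exact ⟨B, hBB, hB, hpos B hBB⟩

theorem ForcingContext.not_disjoint_self {w k Q X : M} (c : ForcingContext w k Q)
    (hX : IsPosClass w Q X) : ¬ DisjointClasses w Q X X := by
  obtain ⟨B, hB, -, hBI⟩ := c.exists_borel_mem hX
  exact fun H => hBI (H B B B hB hB fun x => (and_self_iff).symm)

/-- Conditions contained in disjoint classes are incompatible. -/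
theorem ForcingContext.not_compat {w k Q X Y B C p q : M} (c : ForcingContext w k Q)
    (hXY : DisjointClasses w Q X Y) (hB : B ε X) (hC : C ε Y)
    (hp : IsMeagerPred w Q (fun x => IsBranch w p x ∧ ¬ x ε B))
    (hq : IsMeagerPred w Q (fun x => IsBranch w q x ∧ ¬ x ε C)) : ¬ Compat Q p q := by
  rintro ⟨r, hr, hrp, hrq⟩
  obtain ⟨D, hD⟩ := c.zf.sep (fun x => x ε C) B
  have hDm := ((c.inIdeal_iff D).1 (hXY B C D hB hC hD)).2
  refine c.not_isMeagerPred_branch hr (((hp.or c.zf hq).or c.zf hDm).mono fun x _ hx => ?_)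
  by_cases hxB : x ε B
  · by_cases hxC : x ε C
    · exact Or.inr ((hD x).2 ⟨hxB, hxC⟩)
    · exact Or.inl (Or.inr ⟨hx.mono hrq, hxC⟩)
  · exact Or.inl (Or.inl ⟨hx.mono hrp, hxB⟩)

/-- Let `S` consist of the conditions almost contained in a representative of some class in `A`, and
let `E` be a countable predense subset. A condition for `X` is compatible with some `e ∈ E`, so `e`
belongs to `X` too; as `e` belongs to no other class, `A` is an image of `E`. -/
theorem ForcingContext.antichain_countable {w k Q A : M} (c : ForcingContext w k Q)
    (hA : ∀ X, X ε A → IsPosClass w Q X)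
    (hdis : ∀ X Y, X ε A → Y ε A → X ≠ Y → DisjointClasses w Q X Y) : IsCountable w A := by
  have h := c.zf
  obtain ⟨S, hS⟩ := h.sep (fun q => ∃ X B, X ε A ∧ B ε X ∧
    IsMeagerPred w Q (fun x => IsBranch w q x ∧ ¬ x ε B)) Q
  obtain ⟨E, hES, hE, hEd⟩ := c.exists_countable_predense fun q hq => ((hS q).1 hq).1
  refine hE.image h c.omega
    (fun q X => ∃ B, B ε X ∧ IsMeagerPred w Q (fun x => IsBranch w q x ∧ ¬ x ε B)) ?_ ?_
  · intro X hX
    obtain ⟨B, hBX, hB, hBI⟩ := c.exists_borel_mem (hA X hX)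
    obtain ⟨q, hq, hqB⟩ := c.exists_condition hB hBI
    obtain ⟨e, he, hqe⟩ := hEd q ((hS q).2 ⟨hq, X, B, hX, hBX, hqB⟩)
    obtain ⟨-, Y, C, hY, hCY, heC⟩ := (hS e).1 (hES e he)
    have hXY : X = Y := by_contra fun hXY =>
      c.not_compat (hdis X Y hX hY hXY) hBX hCY hqB heC hqe
    subst hXY
    exact ⟨e, he, C, hCY, heC⟩
  · rintro q X Y hq hX hY ⟨B, hB, hqB⟩ ⟨C, hC, hqC⟩
    have hqQ := ((hS q).1 (hES q hq)).1
    exact by_contra fun hXY => c.not_compat (hdis X Y hX hY hXY) hB hC hqB hqC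
      ⟨q, hqQ, Sub.refl q, Sub.refl q⟩

theorem ForcingContext.borelQuotientCCC {w k Q : M} (c : ForcingContext w k Q) :
    BorelQuotientCCC w k Q := by
  have h := c.zf
  refine ⟨?_, fun A => c.antichain_countable⟩
  rintro ⟨f, A, hA, hf, hdis⟩
  obtain ⟨A', hA'⟩ := h.sep (fun X => ∃ a, PairMem f a X) A
  have hcount : IsCountable w A' := by
    refine c.antichain_countable (fun X hX => hA X ((hA' X).1 hX).1) fun X Y hX hY hXY => ?_
    obtain ⟨-, a, ha⟩ := (hA' X).1 hX
    obtain ⟨-, b, hb⟩ := (hA' Y).1 hY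
    refine hdis a b X Y ?_ ha hb
    rintro rfl
    exact hXY (hf.eq ha hb)
  -- The sequence is injective, since a nonzero class is not disjoint from itself. Inverting it
  -- makes `ω₁` an image of its countable range.
  refine c.omegaOne.2.1 (hcount.image h c.omega (fun X a => PairMem f a X) ?_ ?_)
  · intro a ha
    obtain ⟨X, hX, haX⟩ := hf.exists_val ha
    exact ⟨X, (hA' X).2 ⟨hX, a, haX⟩, haX⟩
  · intro X a b hX _ _ ha hb
    exact by_contra fun hab => c.not_disjoint_self (hA X ((hA' X).1 hX).1) (hdis a b X X hab ha hb)

end BorelQuotient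

end SetModel

/-- `ZF + DC_{ω₁}` proves: if `Q` is a Suslin ccc forcing notion (of perfect trees), then
`Borel(ω^ω) / I_{Q,ℵ₀}` is ccc. -/
theorem claim14 (M : Type*) [SetModel.setLang.Structure M]
    (hZF : SetModel.IsZF M) (hDC : SetModel.DCOmegaOne M)
    (w k : M) (hw : SetModel.IsOmega w) (hk : SetModel.IsOmegaOne w k)
    (Q : M) (hQ : SetModel.IsSuslinCCCTreeForcing w k Q) :
    SetModel.BorelQuotientCCC w k Q :=
  SetModel.ForcingContext.borelQuotientCCC ⟨hZF, hDC, hw, hk, hQ⟩
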